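/- Let $n\ge 0$ be an integer. Let $\mathcal P_n=\{i^k\sigma_1\otimes\cdots\otimes\sigma_n : k\in\{0,1,2,3\},\ \sigma_j\in\{I,X,Y,Z\}\}$ be the $n$-qubit Pauli group, and let $\mathrm{Cl}(2^n)$ be the $n$-qubit Clifford group, that is, the normalizer of $\mathcal P_n$ in the unitary group $\mathrm U(2^n)$ modulo global phases; it is a finite group. For $U\in\mathrm{Cl}(2^n)$ let $P_U(x)=|\langle x|U|0^n\rangle|^2$, $x\in\{0,1\}^n$, be the Born (output) distribution of $U$, which does not depend on the global phase, and let $\mathcal U$ be the uniform distribution on $\{0,1\}^n$. If $U$ is drawn uniformly at random from $\mathrm{Cl}(2^n)$, then $$\Pr_{U\sim\mathrm{Cl}(2^n)}\left(P_U=\mathcal U\right)=\frac{1}{\prod_{i=1}^{n}\left(1+\frac{1}{2^{i}}\right)}.$$ Moreover, as $n\to\infty$ this probability converges from above to a limit $L=0.41942244\ldots$ (that is, it is larger than $L$ for every $n$, and $0.41942244\le L<0.41942245$), and for every $n$ it is larger than $0.41$. -/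

import Mathlib

open Filter Topology

noncomputable section

namespace CliffordUniform

/-- Bit strings of length `n`, the labels of the computational basis of `n` qubits. -/
abbrev Bits (n : ℕ) : Type := Fin n → Fin 2

/-- The unitary group `U(2^n)`, matrices being indexed by bit strings. -/
abbrev QubitUnitary (n : ℕ) : Type := Matrix.unitaryGroup (Bits n) ℂ

/-- The single-qubit Pauli matrices `I, X, Y, Z`. -/
def pauli : Fin 4 → Matrix (Fin 2) (Fin 2) ℂ :=
  ![1, !![0, 1; 1, 0], !![0, -Complex.I; Complex.I, 0], !![1, 0; 0, -1]]

/-- The tensor product `σ_{p 0} ⊗ ⋯ ⊗ σ_{p (n-1)}` of single-qubit Pauli matrices. -/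
def pauliString {n : ℕ} (p : Fin n → Fin 4) : Matrix (Bits n) (Bits n) ℂ :=
  Matrix.of fun x y => ∏ i, pauli (p i) (x i) (y i)

lemma pauli_mul (a b : Fin 4) :
    ∃ (k : ℕ) (c : Fin 4), pauli a * pauli b = Complex.I ^ k • pauli c := by
  fin_cases a <;> fin_cases b
  · exact ⟨0, 0, by simp [pauli]⟩
  · exact ⟨0, 1, by simp [pauli]⟩
  · exact ⟨0, 2, by simp [pauli]⟩
  · exact ⟨0, 3, by simp [pauli]⟩
  · exact ⟨0, 1, by simp [pauli]⟩
  · exact ⟨0, 0, by ext i j; fin_cases i <;> fin_cases j <;> simp [pauli]⟩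
  · exact ⟨1, 3, by ext i j; fin_cases i <;> fin_cases j <;> simp [pauli]⟩
  · exact ⟨3, 2, by ext i j; fin_cases i <;> fin_cases j <;> simp [pauli, pow_succ]⟩
  · exact ⟨0, 2, by simp [pauli]⟩
  · exact ⟨3, 3, by ext i j; fin_cases i <;> fin_cases j <;> simp [pauli, pow_succ]⟩
  · exact ⟨0, 0, by ext i j; fin_cases i <;> fin_cases j <;> simp [pauli]⟩
  · exact ⟨1, 1, by ext i j; fin_cases i <;> fin_cases j <;> simp [pauli]⟩
  · exact ⟨0, 3, by simp [pauli]⟩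
  · exact ⟨1, 2, by ext i j; fin_cases i <;> fin_cases j <;> simp [pauli]⟩
  · exact ⟨3, 1, by ext i j; fin_cases i <;> fin_cases j <;> simp [pauli, pow_succ]⟩
  · exact ⟨0, 0, by ext i j; fin_cases i <;> fin_cases j <;> simp [pauli]⟩

lemma pauli_star (a : Fin 4) : star (pauli a) = pauli a := by
  fin_cases a <;> ext i j <;> fin_cases i <;> fin_cases j <;> simp [pauli]

lemma pauliString_mul {n : ℕ} (p q : Fin n → Fin 4) :
    ∃ (k : ℕ) (r : Fin n → Fin 4),
      pauliString p * pauliString q = Complex.I ^ k • pauliString r := by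
  choose k c h using pauli_mul
  refine ⟨∑ i, k (p i) (q i), fun i => c (p i) (q i), ?_⟩
  ext x y
  have h' : ∀ i, (pauli (p i) * pauli (q i)) (x i) (y i) =
      Complex.I ^ k (p i) (q i) * pauli (c (p i) (q i)) (x i) (y i) := fun i => by
    rw [h]; simp
  simp only [pauliString, Matrix.mul_apply, Matrix.of_apply, Matrix.smul_apply, smul_eq_mul,
    ← Finset.prod_mul_distrib, ← Finset.prod_pow_eq_pow_sum]
  rw [← Finset.prod_congr rfl fun i _ => h' i]
  simp only [Matrix.mul_apply]
  rw [Finset.prod_univ_sum, Fintype.piFinset_univ]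

lemma pauliString_star {n : ℕ} (p : Fin n → Fin 4) : star (pauliString p) = pauliString p := by
  ext x y
  have h : ∀ i, star (pauli (p i) (y i) (x i)) = pauli (p i) (x i) (y i) := fun i => by
    conv_rhs => rw [← pauli_star]
    rfl
  simp only [Matrix.star_apply, pauliString, Matrix.of_apply, star_prod, h]

/-- The `n`-qubit Pauli group `{i^k σ_{p 0} ⊗ ⋯ ⊗ σ_{p (n-1)}}`. -/
def pauliGroup (n : ℕ) : Subgroup (QubitUnitary n) where
  carrier := {U | ∃ (k : ℕ) (p : Fin n → Fin 4),
    (U : Matrix (Bits n) (Bits n) ℂ) = Complex.I ^ k • pauliString p}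
  one_mem' := by
    refine ⟨0, fun _ => 0, ?_⟩
    ext x y
    simp only [pauliString, pauli, Matrix.of_apply, pow_zero, one_smul, Matrix.cons_val_zero,
      Matrix.one_apply, Matrix.UnitaryGroup.one_val, Finset.prod_ite_zero, Finset.prod_const_one,
      funext_iff, Finset.mem_univ, true_implies]
  mul_mem' := by
    rintro U V ⟨k, p, hU⟩ ⟨l, q, hV⟩
    obtain ⟨m, r, h⟩ := pauliString_mul p q
    refine ⟨k + l + m, r, ?_⟩
    rw [Matrix.UnitaryGroup.mul_val, hU, hV, Matrix.smul_mul, Matrix.mul_smul, h, smul_smul,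
      smul_smul, pow_add, pow_add, mul_assoc]
  inv_mem' := by
    rintro U ⟨k, p, hU⟩
    refine ⟨3 * k, p, ?_⟩
    rw [Matrix.UnitaryGroup.inv_val, hU, star_smul, pauliString_star, pow_mul]
    simp [pow_succ]

/-- The Clifford unitaries: the normalizer of the Pauli group in `U(2^n)`. -/
def cliffordUnitaries (n : ℕ) : Subgroup (QubitUnitary n) :=
  Subgroup.normalizer (pauliGroup n : Set (QubitUnitary n))

/-- The global phases `z · 1` with `|z| = 1`. -/
def phases (n : ℕ) : Subgroup (QubitUnitary n) where
  carrier := {U | ∃ z : Circle, (U : Matrix (Bits n) (Bits n) ℂ) = (z : ℂ) • 1}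
  one_mem' := ⟨1, by simp⟩
  mul_mem' := by
    rintro U V ⟨z, hU⟩ ⟨w, hV⟩
    refine ⟨z * w, ?_⟩
    rw [Matrix.UnitaryGroup.mul_val, hU, hV]
    simp [smul_smul, mul_comm]
  inv_mem' := by
    rintro U ⟨z, hU⟩
    refine ⟨z⁻¹, ?_⟩
    rw [Matrix.UnitaryGroup.inv_val, hU, star_smul, Circle.coe_inv_eq_conj]
    simp

/-- The `n`-qubit Clifford group `Cl(2^n)`: Clifford unitaries up to a global phase. -/
abbrev Clifford (n : ℕ) : Type :=
  cliffordUnitaries n ⧸ (phases n).subgroupOf (cliffordUnitaries n)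

/-- The Born distribution `P_U(x) = |⟨x|U|0^n⟩|²` of a unitary. -/
def born {n : ℕ} (U : QubitUnitary n) (x : Bits n) : ℝ :=
  ‖(U : Matrix (Bits n) (Bits n) ℂ) x 0‖ ^ 2

lemma born_mul_phase {n : ℕ} (U V : QubitUnitary n) (hV : V ∈ phases n) :
    born (U * V) = born U := by
  obtain ⟨z, hz⟩ := hV
  funext x
  simp [born, hz, Circle.norm_coe]

/-- The Born distribution of an element of the Clifford group, which does not depend on the
choice of the global phase. -/
def Clifford.born {n : ℕ} : Clifford n → Bits n → ℝ :=
  Quotient.lift (fun U : cliffordUnitaries n => CliffordUniform.born (U : QubitUnitary n)) (by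
    intro U V h
    have h' := Subgroup.mem_subgroupOf.1 (QuotientGroup.leftRel_apply.1 h)
    have := born_mul_phase (U : QubitUnitary n) _ h'
    simpa using this.symm)

/-- The probability mass function of the uniform distribution on bit strings. -/
def uniformDist (n : ℕ) (_ : Bits n) : ℝ := 1 / 2 ^ n

/-- All events in the Clifford group are measurable. -/
instance Clifford.measurableSpace (n : ℕ) : MeasurableSpace (Clifford n) := ⊤

/-- The probability, over a uniformly random `U ∈ Cl(2^n)` (every element of the finite group
`Cl(2^n)` being equally likely), that `P_U` is the uniform distribution. -/
def probUniform (n : ℕ) : ℝ :=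
  (ProbabilityTheory.uniformOn (Set.univ : Set (Clifford n))).real
    {U : Clifford n | U.born = uniformDist n}

end CliffordUniform

end

/-! Whether `P_U` is uniform depends only on the ray of `U|0⟩`, so the probability is a ratio of two
counts of rays. The Clifford group acts transitively on itself and the ray map is equivariant. All
its fibres therefore have the same size (`card_preimage_eq_mul`), and this size cancels.

The rays are identified intrinsically. `IsStab` asks that each Pauli string have `ψ` as an
eigenvector or have expectation zero. Cliffords preserve this, and conversely `IsStab.reach`
rebuilds such a vector from `|0⟩` by Clifford operations.

The counting is by induction on qubits. By `IsStab.join_cases`, a state on `n + 1` qubits is `|0⟩φ`,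
`|1⟩φ`, or `(|0⟩φ + i^k |1⟩Pφ)/√2` with `φ` a stabilizer state and `P` a Pauli string. Up to phase,
the vectors `Pφ` are the columns of a Clifford preparing `φ`. Each ray of `φ` thus has `2 + 4·2^n`
extensions. Exactly the `4·2^n` superpositions of a uniform `φ` are uniform, so each step
contributes the factor `1 / (1 + 2^{-(n+1)})`.

The limit follows from strict monotonicity of the partial products and an explicit tail estimate. -/

noncomputable section

namespace CliffordUniform

open Matrix Complex

/-! ### Pauli strings and conjugation by Clifford unitaries -/

lemma pauli_mul_self (a : Fin 4) : pauli a * pauli a = 1 := by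
  fin_cases a <;> ext i j <;> fin_cases i <;> fin_cases j <;> simp [pauli]

lemma pauli_comm (a b : Fin 4) :
    ∃ e : ℤˣ, pauli a * pauli b = ((e : ℤ) : ℂ) • (pauli b * pauli a) := by
  by_cases h : a = b ∨ a = 0 ∨ b = 0
  · refine ⟨1, ?_⟩
    rcases h with rfl | rfl | rfl <;> simp [pauli]
  · push Not at h
    refine ⟨-1, ?_⟩
    fin_cases a <;> fin_cases b <;> simp at h <;>
      ext i j <;> fin_cases i <;> fin_cases j <;> simp [pauli]

lemma pauliString_mul_apply {n : ℕ} (p q : Fin n → Fin 4) (x y : Bits n) :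
    (pauliString p * pauliString q) x y = ∏ i, (pauli (p i) * pauli (q i)) (x i) (y i) := by
  simp only [pauliString, Matrix.mul_apply, Matrix.of_apply, ← Finset.prod_mul_distrib]
  rw [Finset.prod_univ_sum, Fintype.piFinset_univ]

lemma one_apply_eq_prod {n : ℕ} (x y : Bits n) :
    (1 : Matrix (Bits n) (Bits n) ℂ) x y =
      ∏ i, (1 : Matrix (Fin 2) (Fin 2) ℂ) (x i) (y i) := by
  simp only [Matrix.one_apply, Finset.prod_ite_zero, Finset.prod_const_one,
      funext_iff, Finset.mem_univ, true_implies]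

lemma pauliString_mul_self {n : ℕ} (p : Fin n → Fin 4) : pauliString p * pauliString p = 1 := by
  ext x y
  simp only [pauliString_mul_apply, pauli_mul_self, one_apply_eq_prod]

lemma pauliString_zero {n : ℕ} : pauliString (fun _ : Fin n => 0) = 1 := by
  ext x y
  simp [one_apply_eq_prod, pauliString, pauli]

/-- Each qubit contributes a sign, and a product of signs is again a sign. -/
lemma pauliString_comm {n : ℕ} (p q : Fin n → Fin 4) :
    pauliString p * pauliString q = pauliString q * pauliString p ∨
      pauliString p * pauliString q = -(pauliString q * pauliString p) := by
  choose e he using pauli_comm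
  have key : pauliString p * pauliString q =
      (((∏ i, e (p i) (q i) : ℤˣ) : ℤ) : ℂ) • (pauliString q * pauliString p) := by
    ext x y
    rw [Matrix.smul_apply, pauliString_mul_apply, pauliString_mul_apply]
    simp only [he (p _) (q _), Matrix.smul_apply, smul_eq_mul, Finset.prod_mul_distrib]
    simp
  rcases Int.units_eq_one_or (∏ i, e (p i) (q i)) with h | h
  · left; simpa [h] using key
  · right; simpa [h] using key

lemma pauliString_mem_unitary {n : ℕ} (p : Fin n → Fin 4) :
    pauliString p ∈ Matrix.unitaryGroup (Bits n) ℂ := by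
  rw [Matrix.mem_unitaryGroup_iff, pauliString_star, pauliString_mul_self]

/-- A Pauli string as a unitary. -/
def pauliUnitary {n : ℕ} (p : Fin n → Fin 4) : QubitUnitary n :=
  ⟨pauliString p, pauliString_mem_unitary p⟩

lemma pauliUnitary_mem {n : ℕ} (p : Fin n → Fin 4) : pauliUnitary p ∈ pauliGroup n :=
  ⟨0, p, by simp [pauliUnitary]⟩

lemma I_pow_fin (k : ℕ) : ∃ j : Fin 4, I ^ k = I ^ (j : ℕ) := by
  refine ⟨⟨k % 4, Nat.mod_lt _ (by norm_num)⟩, ?_⟩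
  conv_lhs => rw [← Nat.div_add_mod k 4]
  simp [pow_add, pow_mul]

instance finite_pauliGroup (n : ℕ) : Finite (pauliGroup n) := by
  have hfin : (Set.range fun jp : Fin 4 × (Fin n → Fin 4) =>
      I ^ (jp.1 : ℕ) • pauliString jp.2).Finite := Set.finite_range _
  have := hfin.to_subtype
  refine Finite.of_injective (β := Set.range fun jp : Fin 4 × (Fin n → Fin 4) =>
      I ^ (jp.1 : ℕ) • pauliString jp.2) (fun U => ⟨(U : QubitUnitary n), ?_⟩) ?_
  · obtain ⟨k, p, h⟩ := U.2
    obtain ⟨j, hj⟩ := I_pow_fin k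
    exact ⟨(j, p), by rw [h, hj]⟩
  · intro U V h
    exact Subtype.ext (Subtype.ext (by simpa using h))

/-- A unitary that conjugates every Pauli string into the Pauli group is Clifford. -/
lemma mem_clifford_of_conj {n : ℕ} {U : QubitUnitary n}
    (h : ∀ q : Fin n → Fin 4, ∃ (k : ℕ) (r : Fin n → Fin 4),
      (U : Matrix (Bits n) (Bits n) ℂ) * pauliString q * star (U : Matrix (Bits n) (Bits n) ℂ) =
        I ^ k • pauliString r) :
    U ∈ cliffordUnitaries n := by
  have : Finite ((pauliGroup n : Set (QubitUnitary n))) := finite_pauliGroup n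
  -- Since the Pauli group is finite, mapping it into itself already forces mapping it onto itself.
  refine Subgroup.mem_normalizer_fintype ?_
  rintro V ⟨l, q, hV⟩
  obtain ⟨k, r, hr⟩ := h q
  refine ⟨l + k, r, ?_⟩
  rw [Matrix.UnitaryGroup.mul_val, Matrix.UnitaryGroup.mul_val, Matrix.UnitaryGroup.inv_val, hV,
    Matrix.mul_smul, Matrix.smul_mul, hr, smul_smul, pow_add]

lemma clifford_conj {n : ℕ} {U : QubitUnitary n} (hU : U ∈ cliffordUnitaries n)
    (q : Fin n → Fin 4) : ∃ (k : ℕ) (r : Fin n → Fin 4),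
      (U : Matrix (Bits n) (Bits n) ℂ) * pauliString q =
        I ^ k • (pauliString r * (U : Matrix (Bits n) (Bits n) ℂ)) := by
  obtain ⟨k, r, h⟩ := (Subgroup.mem_normalizer_iff.1 hU _).1 (pauliUnitary_mem q)
  refine ⟨k, r, ?_⟩
  rw [Matrix.UnitaryGroup.mul_val, Matrix.UnitaryGroup.mul_val, Matrix.UnitaryGroup.inv_val] at h
  rw [← Matrix.smul_mul, ← h, Matrix.mul_assoc _ (star _), Matrix.UnitaryGroup.star_mul_self,
    Matrix.mul_one]
  rfl

lemma clifford_conj' {n : ℕ} {U : QubitUnitary n} (hU : U ∈ cliffordUnitaries n)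
    (q : Fin n → Fin 4) : ∃ (k : ℕ) (r : Fin n → Fin 4),
      pauliString q * (U : Matrix (Bits n) (Bits n) ℂ) =
        I ^ k • ((U : Matrix (Bits n) (Bits n) ℂ) * pauliString r) := by
  obtain ⟨k, r, h⟩ := clifford_conj (Subgroup.inv_mem _ hU) q
  refine ⟨k, r, ?_⟩
  have h1 : (U : Matrix (Bits n) (Bits n) ℂ) * ((U⁻¹ : QubitUnitary n) : Matrix _ _ ℂ) = 1 := by
    rw [← Matrix.UnitaryGroup.mul_val, mul_inv_cancel, Matrix.UnitaryGroup.one_val]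
  have h2 : ((U⁻¹ : QubitUnitary n) : Matrix _ _ ℂ) * (U : Matrix (Bits n) (Bits n) ℂ) = 1 := by
    rw [← Matrix.UnitaryGroup.mul_val, inv_mul_cancel, Matrix.UnitaryGroup.one_val]
  calc _ = (U : Matrix (Bits n) (Bits n) ℂ) * (((U⁻¹ : QubitUnitary n) : Matrix _ _ ℂ) *
        pauliString q) * (U : Matrix (Bits n) (Bits n) ℂ) := by
        rw [← Matrix.mul_assoc, h1, Matrix.one_mul]
    _ = _ := by
        rw [h, Matrix.mul_smul, Matrix.smul_mul, Matrix.mul_assoc, Matrix.mul_assoc, h2,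
          Matrix.mul_one]

lemma pauliUnitary_mem_clifford {n : ℕ} (p : Fin n → Fin 4) :
    pauliUnitary p ∈ cliffordUnitaries n :=
  Subgroup.le_normalizer (pauliUnitary_mem p)

lemma phases_le_clifford (n : ℕ) : phases n ≤ cliffordUnitaries n := by
  rintro U ⟨z, hU⟩
  refine mem_clifford_of_conj fun q => ⟨0, q, ?_⟩
  rw [hU]
  have hz : (starRingEnd ℂ) (z : ℂ) * z = 1 := by
    rw [Complex.conj_mul', Circle.norm_coe]; simp
  simp [smul_smul, hz]

/-! ### Pauli rotations -/

lemma inv_sqrt_two_mul_self : ((√2 : ℝ) : ℂ)⁻¹ * ((√2 : ℝ) : ℂ)⁻¹ = 1 / 2 := by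
  rw [← mul_inv, ← ofReal_mul, Real.mul_self_sqrt (by norm_num)]
  norm_num

/-- The rotation `exp(i π P / 4) = (1 + i P) / √2` for a Pauli string `P`. -/
def pauliRotation {n : ℕ} (p : Fin n → Fin 4) : Matrix (Bits n) (Bits n) ℂ :=
  ((√2 : ℝ) : ℂ)⁻¹ • (1 + I • pauliString p)

lemma star_pauliRotation {n : ℕ} (p : Fin n → Fin 4) :
    star (pauliRotation p) = ((√2 : ℝ) : ℂ)⁻¹ • (1 - I • pauliString p) := by
  rw [pauliRotation, star_smul, star_add, star_smul, star_one, pauliString_star]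
  simp [sub_eq_add_neg]

/-- Stated for arbitrary `Q` because it serves twice: `Q = 1` gives unitarity, and `Q` a Pauli
string gives the Clifford property. -/
lemma pauliRotation_conj {n : ℕ} (p : Fin n → Fin 4) (Q : Matrix (Bits n) (Bits n) ℂ) :
    pauliRotation p * Q * star (pauliRotation p) = (1 / 2 : ℂ) •
      (Q + I • (pauliString p * Q) - I • (Q * pauliString p) +
        pauliString p * Q * pauliString p) := by
  rw [star_pauliRotation, pauliRotation, Matrix.smul_mul, Matrix.smul_mul, Matrix.mul_smul,
    smul_smul, inv_sqrt_two_mul_self]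
  congr 1
  simp only [Matrix.add_mul, Matrix.one_mul, Matrix.mul_sub, Matrix.mul_one, Matrix.mul_smul,
    Matrix.smul_mul, smul_smul, I_mul_I, smul_add]
  module

lemma pauliRotation_mem_unitary {n : ℕ} (p : Fin n → Fin 4) :
    pauliRotation p ∈ Matrix.unitaryGroup (Bits n) ℂ := by
  rw [Matrix.mem_unitaryGroup_iff]
  have h := pauliRotation_conj p 1
  rw [Matrix.mul_one] at h
  rw [h]
  simp only [Matrix.mul_one, Matrix.one_mul, pauliString_mul_self]
  module

/-- With `P` the string of the rotation, conjugation fixes a string `Q` commuting with `P` and sends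
an anticommuting `Q` to `i P Q`. -/
lemma pauliRotation_mem_clifford {n : ℕ} (p : Fin n → Fin 4) :
    (⟨pauliRotation p, pauliRotation_mem_unitary p⟩ : QubitUnitary n) ∈ cliffordUnitaries n := by
  refine mem_clifford_of_conj fun q => ?_
  change ∃ k r, pauliRotation p * pauliString q * star (pauliRotation p) = _
  rw [pauliRotation_conj]
  rcases pauliString_comm p q with h | h
  · refine ⟨0, q, ?_⟩
    rw [h, Matrix.mul_assoc, pauliString_mul_self, Matrix.mul_one]
    module
  · obtain ⟨k, r, hr⟩ := pauliString_mul p q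
    refine ⟨1 + k, r, ?_⟩
    have h' : pauliString q * pauliString p = -(pauliString p * pauliString q) := by
      rw [h, neg_neg]
    rw [Matrix.mul_assoc, h', Matrix.mul_neg, ← Matrix.mul_assoc, pauliString_mul_self,
      Matrix.one_mul, pow_add, mul_smul, ← hr]
    module

/-! ### Pauli strings span the matrix algebra -/

lemma exists_pauli_combination (b c : Fin 2) :
    ∃ k : Fin 4 → ℂ, ∀ i j, ∑ a, k a * pauli a i j = if i = b ∧ j = c then 1 else 0 := by
  fin_cases b <;> fin_cases c
  · refine ⟨![1 / 2, 0, 0, 1 / 2], fun i j => ?_⟩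
    fin_cases i <;> fin_cases j <;> simp [Fin.sum_univ_four, pauli]; norm_num
  · refine ⟨![0, 1 / 2, I / 2, 0], fun i j => ?_⟩
    fin_cases i <;> fin_cases j <;> simp [Fin.sum_univ_four, pauli, div_mul_eq_mul_div] <;> norm_num
  · refine ⟨![0, 1 / 2, -I / 2, 0], fun i j => ?_⟩
    fin_cases i <;> fin_cases j <;> simp [Fin.sum_univ_four, pauli, div_mul_eq_mul_div]; norm_num
  · refine ⟨![1 / 2, 0, 0, -1 / 2], fun i j => ?_⟩
    fin_cases i <;> fin_cases j <;> simp [Fin.sum_univ_four, pauli] <;> norm_num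

/-- Pauli strings span all matrices. -/
lemma span_pauliString (n : ℕ) :
    Submodule.span ℂ (Set.range (pauliString (n := n))) = ⊤ := by
  rw [eq_top_iff]
  rintro A -
  rw [Matrix.matrix_eq_sum_single A]
  refine Submodule.sum_mem _ fun x _ => Submodule.sum_mem _ fun y _ => ?_
  choose k hk using exists_pauli_combination
  have h : Matrix.single x y (A x y) =
      ∑ p : Fin n → Fin 4, (A x y * ∏ i, k (x i) (y i) (p i)) • pauliString p := by
    ext u v
    rw [Matrix.sum_apply]
    simp only [Matrix.smul_apply, smul_eq_mul, pauliString, Matrix.of_apply, mul_assoc,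
      ← Finset.prod_mul_distrib, ← Finset.mul_sum]
    have : ∑ p : Fin n → Fin 4, ∏ i, k (x i) (y i) (p i) * pauli (p i) (u i) (v i) =
        ∏ i, ∑ a, k (x i) (y i) a * pauli a (u i) (v i) := by
      rw [Finset.prod_univ_sum, Fintype.piFinset_univ]
    rw [this]
    have hxy : (∀ i, u i = x i ∧ v i = y i) ↔ x = u ∧ y = v := by
      rw [forall_and, ← funext_iff, ← funext_iff, eq_comm, @eq_comm _ v]
    simp only [hk, Finset.prod_ite_zero, Finset.prod_const_one, Matrix.single_apply,
      Finset.mem_univ, true_implies, hxy, mul_ite, mul_one, mul_zero]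
  rw [h]
  exact Submodule.sum_mem _ fun p _ => Submodule.smul_mem _ _ (Submodule.subset_span ⟨p, rfl⟩)

/-- Otherwise, by spanning, the form `u* A v` would vanish for every matrix `A`. A matrix unit
placed at nonzero entries of `u` and `v` rules this out. -/
lemma exists_pauliString_overlap_ne_zero {n : ℕ} {u v : Bits n → ℂ} (hu : u ≠ 0) (hv : v ≠ 0) :
    ∃ p : Fin n → Fin 4, star u ⬝ᵥ (pauliString p *ᵥ v) ≠ 0 := by
  by_contra! h
  have hA : ∀ A : Matrix (Bits n) (Bits n) ℂ, star u ⬝ᵥ (A *ᵥ v) = 0 := by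
    intro A
    have hA : A ∈ Submodule.span ℂ (Set.range (pauliString (n := n))) := by
      rw [span_pauliString]; trivial
    induction hA using Submodule.span_induction with
    | mem A hA => obtain ⟨p, rfl⟩ := hA; exact h p
    | zero => simp
    | add A B _ _ hA hB => simp [Matrix.add_mulVec, hA, hB]
    | smul c A _ hA => simp [Matrix.smul_mulVec, hA]
  obtain ⟨x, hx⟩ := Function.ne_iff.1 hu
  obtain ⟨y, hy⟩ := Function.ne_iff.1 hv
  have h1 := hA (Matrix.single x y 1)
  have h2 : Matrix.single x y (1 : ℂ) *ᵥ v = Pi.single x (v y) := by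
    rw [Matrix.single_mulVec, one_mul]; rfl
  rw [h2, dotProduct_single] at h1
  simp_all

/-- A matrix commuting with all Pauli strings is scalar. -/
lemma eq_smul_one_of_commute {n : ℕ} {M : Matrix (Bits n) (Bits n) ℂ}
    (h : ∀ p, M * pauliString p = pauliString p * M) : ∃ z : ℂ, M = z • 1 := by
  have hM : ∀ A : Matrix (Bits n) (Bits n) ℂ, M * A = A * M := by
    intro A
    have hA : A ∈ Submodule.span ℂ (Set.range (pauliString (n := n))) := by
      rw [span_pauliString]; trivial
    induction hA using Submodule.span_induction with
    | mem A hA => obtain ⟨p, rfl⟩ := hA; exact h p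
    | zero => simp
    | add A B _ _ hA hB => rw [mul_add, add_mul, hA, hB]
    | smul c A _ hA => rw [Matrix.mul_smul, Matrix.smul_mul, hA]
  obtain ⟨z, hz⟩ := Matrix.mem_range_scalar_of_commute_single (M := M)
    (fun i j _ => (hM _).symm)
  exact ⟨z, by rw [← hz]; ext i j; simp [Matrix.scalar_apply, Matrix.diagonal_apply,
    Matrix.one_apply]⟩

/-! ### Stabilizer vectors and their invariance under Cliffords -/

/-- A unit vector whose Pauli string expectations vanish unless it is an eigenvector. -/
structure IsStab {n : ℕ} (ψ : Bits n → ℂ) : Prop where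
  unit : star ψ ⬝ᵥ ψ = 1
  eigen : ∀ p, (∃ c : ℂ, pauliString p *ᵥ ψ = c • ψ) ∨ star ψ ⬝ᵥ (pauliString p *ᵥ ψ) = 0

/-- Vectors reachable from `|0⋯0⟩` by phases, Pauli strings and Pauli rotations. -/
inductive Reach {n : ℕ} : (Bits n → ℂ) → Prop
  | basis : Reach (Pi.single 0 1)
  | smul (z : ℂ) (ψ : Bits n → ℂ) : star z * z = 1 → Reach ψ → Reach (z • ψ)
  | pauli (p : Fin n → Fin 4) (ψ : Bits n → ℂ) : Reach ψ → Reach (pauliString p *ᵥ ψ)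
  | rotate (p : Fin n → Fin 4) (ψ : Bits n → ℂ) : Reach ψ → Reach (pauliRotation p *ᵥ ψ)

lemma pauliRotation_mulVec {n : ℕ} (p : Fin n → Fin 4) (ψ : Bits n → ℂ) :
    pauliRotation p *ᵥ ψ = ((√2 : ℝ) : ℂ)⁻¹ • (ψ + I • (pauliString p *ᵥ ψ)) := by
  rw [pauliRotation, Matrix.smul_mulVec, Matrix.add_mulVec, Matrix.one_mulVec, Matrix.smul_mulVec]

lemma Reach.exists_clifford {n : ℕ} {ψ : Bits n → ℂ} (h : Reach ψ) :
    ∃ U ∈ cliffordUnitaries n, ψ = (U : Matrix (Bits n) (Bits n) ℂ) *ᵥ Pi.single 0 1 := by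
  induction h with
  | basis => exact ⟨1, one_mem _, by rw [Matrix.UnitaryGroup.one_val, Matrix.one_mulVec]⟩
  | smul z ψ hz _ ih =>
    obtain ⟨U, hU, rfl⟩ := ih
    have hz' : z ∈ Submonoid.unitSphere ℂ := by
      refine mem_sphere_zero_iff_norm.2 ?_
      have : ‖star z * z‖ = 1 := by rw [hz]; simp
      rw [norm_mul, norm_star] at this
      nlinarith [norm_nonneg z]
    let W : QubitUnitary n := ⟨z • 1, by
      rw [Matrix.mem_unitaryGroup_iff', star_smul, star_one, Matrix.smul_mul, Matrix.mul_smul,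
        smul_smul, hz, Matrix.one_mul, one_smul]⟩
    have hW : W ∈ phases n := ⟨⟨z, hz'⟩, rfl⟩
    refine ⟨W * U, mul_mem (phases_le_clifford n hW) hU, ?_⟩
    rw [Matrix.UnitaryGroup.mul_val, Matrix.smul_mul, Matrix.one_mul, Matrix.smul_mulVec]
  | pauli p ψ _ ih =>
    obtain ⟨U, hU, rfl⟩ := ih
    refine ⟨pauliUnitary p * U, mul_mem (pauliUnitary_mem_clifford p) hU, ?_⟩
    rw [Matrix.UnitaryGroup.mul_val, Matrix.mulVec_mulVec]
    rfl
  | rotate p ψ _ ih =>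
    obtain ⟨U, hU, rfl⟩ := ih
    refine ⟨_ * U, mul_mem (pauliRotation_mem_clifford p) hU, ?_⟩
    rw [Matrix.UnitaryGroup.mul_val, Matrix.mulVec_mulVec]

/-- Pauli matrices are monomial: each column has a single nonzero entry, a power of `i`. -/
lemma pauli_mulVec_single (a : Fin 4) (b : Fin 2) :
    ∃ (k : ℕ) (c : Fin 2), ∀ i, pauli a i b = I ^ k * if i = c then 1 else 0 := by
  fin_cases a <;> fin_cases b
  · exact ⟨0, 0, fun i => by fin_cases i <;> simp [pauli]⟩
  · exact ⟨0, 1, fun i => by fin_cases i <;> simp [pauli]⟩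
  · exact ⟨0, 1, fun i => by fin_cases i <;> simp [pauli]⟩
  · exact ⟨0, 0, fun i => by fin_cases i <;> simp [pauli]⟩
  · exact ⟨1, 1, fun i => by fin_cases i <;> simp [pauli]⟩
  · exact ⟨3, 0, fun i => by fin_cases i <;> simp [pauli, pow_succ]⟩
  · exact ⟨0, 0, fun i => by fin_cases i <;> simp [pauli]⟩
  · exact ⟨2, 1, fun i => by fin_cases i <;> simp [pauli]⟩

lemma pauliString_mulVec_single {n : ℕ} (p : Fin n → Fin 4) (y : Bits n) :
    ∃ (k : ℕ) (x : Bits n), pauliString p *ᵥ Pi.single y 1 = I ^ k • Pi.single x (1 : ℂ) := by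
  choose k c h using pauli_mulVec_single
  refine ⟨∑ i, k (p i) (y i), fun i => c (p i) (y i), ?_⟩
  ext x
  simp only [Matrix.mulVec_single_one, Matrix.col_apply, pauliString, Matrix.of_apply, h,
    Finset.prod_mul_distrib, Finset.prod_pow_eq_pow_sum, Finset.prod_ite_zero, Pi.smul_apply,
    Pi.single_apply, funext_iff, Finset.mem_univ, true_implies, Finset.prod_const_one, smul_eq_mul]

lemma exists_pauliString_mulVec_single {n : ℕ} (x : Bits n) :
    ∃ p, pauliString p *ᵥ Pi.single 0 1 = Pi.single x (1 : ℂ) := by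
  refine ⟨fun i => if x i = 0 then 0 else 1, ?_⟩
  have h : ∀ b i : Fin 2, pauli (if b = 0 then 0 else 1) i 0 = if i = b then 1 else 0 := by
    intro b i
    fin_cases b <;> fin_cases i <;> simp [pauli]
  ext y
  simp only [Matrix.mulVec_single_one, Matrix.col_apply, pauliString, Matrix.of_apply, h,
    Finset.prod_ite_zero, Pi.zero_apply,
    Pi.single_apply, funext_iff, Finset.mem_univ, true_implies, Finset.prod_const_one]

lemma star_dotProduct_unitary {n : ℕ} (U : QubitUnitary n) (u v : Bits n → ℂ) :
    star ((U : Matrix (Bits n) (Bits n) ℂ) *ᵥ u) ⬝ᵥ ((U : Matrix (Bits n) (Bits n) ℂ) *ᵥ v) =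
      star u ⬝ᵥ v := by
  rw [Matrix.star_mulVec, Matrix.dotProduct_mulVec, Matrix.vecMul_vecMul, ← star_eq_conjTranspose,
    Matrix.UnitaryGroup.star_mul_self, Matrix.vecMul_one]

lemma isStab_single (n : ℕ) : IsStab (Pi.single 0 1 : Bits n → ℂ) := by
  refine ⟨by simp, fun p => ?_⟩
  obtain ⟨k, x, h⟩ := pauliString_mulVec_single p 0
  rw [h]
  by_cases hx : x = 0
  · exact Or.inl ⟨I ^ k, by rw [hx]⟩
  · right
    simp [Ne.symm hx]

/-- Moving a Pauli string through `U` turns it into another one up to a power of `i`, and `U`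
preserves inner products. -/
lemma IsStab.clifford {n : ℕ} {ψ : Bits n → ℂ} (h : IsStab ψ) {U : QubitUnitary n}
    (hU : U ∈ cliffordUnitaries n) : IsStab ((U : Matrix (Bits n) (Bits n) ℂ) *ᵥ ψ) := by
  refine ⟨by rw [star_dotProduct_unitary, h.unit], fun p => ?_⟩
  obtain ⟨k, r, hr⟩ := clifford_conj' hU p
  have : pauliString p *ᵥ ((U : Matrix (Bits n) (Bits n) ℂ) *ᵥ ψ) =
      I ^ k • ((U : Matrix (Bits n) (Bits n) ℂ) *ᵥ (pauliString r *ᵥ ψ)) := by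
    rw [Matrix.mulVec_mulVec, hr, Matrix.smul_mulVec, Matrix.mulVec_mulVec]
  rw [this]
  rcases h.eigen r with ⟨c, hc⟩ | h0
  · left
    exact ⟨I ^ k * c, by rw [hc, Matrix.mulVec_smul, smul_smul]⟩
  · right
    rw [dotProduct_smul, star_dotProduct_unitary, h0, smul_zero]

/-! ### Splitting off the first qubit -/

/-- The vector `|0⟩ ⊗ a + |1⟩ ⊗ b`. -/
def join {n : ℕ} (a b : Bits n → ℂ) : Bits (n + 1) → ℂ :=
  fun x => if x 0 = 0 then a (Fin.tail x) else b (Fin.tail x)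

@[simp] lemma join_cons_zero {n : ℕ} (a b : Bits n → ℂ) (x : Bits n) :
    join a b (Fin.cons 0 x : Bits (n + 1)) = a x := by
  simp [join]

@[simp] lemma join_cons_one {n : ℕ} (a b : Bits n → ℂ) (x : Bits n) :
    join a b (Fin.cons 1 x : Bits (n + 1)) = b x := by
  simp [join]

lemma forall_bits_succ {n : ℕ} {P : Bits (n + 1) → Prop} :
    (∀ x, P x) ↔ (∀ x, P (Fin.cons 0 x)) ∧ ∀ x, P (Fin.cons 1 x) := by
  refine ⟨fun h => ⟨fun x => h _, fun x => h _⟩, fun h x => ?_⟩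
  rw [← Fin.cons_self_tail x]
  generalize x 0 = b
  fin_cases b
  · exact h.1 _
  · exact h.2 _

lemma sum_bits_succ {n : ℕ} (f : Bits (n + 1) → ℂ) :
    ∑ x, f x = ∑ x, f (Fin.cons 0 x) + ∑ x, f (Fin.cons 1 x) := by
  rw [← (Fin.consEquiv fun _ => Fin 2).sum_comp, Fintype.sum_prod_type, Fin.sum_univ_two]
  rfl

lemma join_eta {n : ℕ} (ψ : Bits (n + 1) → ℂ) :
    ψ = join (fun x => ψ (Fin.cons 0 x)) (fun x => ψ (Fin.cons 1 x)) := by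
  refine funext (forall_bits_succ.2 ⟨fun x => ?_, fun x => ?_⟩) <;> simp

lemma join_inj {n : ℕ} {a b c d : Bits n → ℂ} : join a b = join c d ↔ a = c ∧ b = d := by
  rw [funext_iff, forall_bits_succ]
  simp [funext_iff]

lemma smul_join {n : ℕ} (z : ℂ) (a b : Bits n → ℂ) : z • join a b = join (z • a) (z • b) := by
  refine funext (forall_bits_succ.2 ⟨fun x => ?_, fun x => ?_⟩) <;> simp

lemma join_add {n : ℕ} (a b c d : Bits n → ℂ) :
    join a b + join c d = join (a + c) (b + d) := by
  refine funext (forall_bits_succ.2 ⟨fun x => ?_, fun x => ?_⟩) <;> simp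

lemma star_join_dotProduct {n : ℕ} (a b c d : Bits n → ℂ) :
    star (join a b) ⬝ᵥ join c d = star a ⬝ᵥ c + star b ⬝ᵥ d := by
  simp [dotProduct, sum_bits_succ]

lemma pauliString_cons_mulVec_join {n : ℕ} (s : Fin 4) (p : Fin n → Fin 4) (a b : Bits n → ℂ) :
    pauliString (Fin.cons s p : Fin (n + 1) → Fin 4) *ᵥ join a b =
      join (pauli s 0 0 • (pauliString p *ᵥ a) + pauli s 0 1 • (pauliString p *ᵥ b))
        (pauli s 1 0 • (pauliString p *ᵥ a) + pauli s 1 1 • (pauliString p *ᵥ b)) := by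
  refine funext (forall_bits_succ.2 ⟨fun x => ?_, fun x => ?_⟩) <;>
    simp [Matrix.mulVec, dotProduct, sum_bits_succ, pauliString, Fin.prod_univ_succ,
      Finset.mul_sum, mul_assoc]

lemma single_zero_succ (n : ℕ) :
    (Pi.single 0 1 : Bits (n + 1) → ℂ) = join (Pi.single 0 1) 0 := by
  refine funext (forall_bits_succ.2 ⟨fun x => ?_, fun x => ?_⟩)
  · have : (Fin.cons 0 x : Bits (n + 1)) = 0 ↔ x = 0 := by
      rw [show (0 : Bits (n + 1)) = Fin.cons 0 0 by
        funext i; refine Fin.cases ?_ (fun j => ?_) i <;> simp, Fin.cons_inj]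
      simp
    simp [Pi.single_apply, this]
  · have : (Fin.cons 1 x : Bits (n + 1)) ≠ 0 := fun h => by
      have := congrFun h 0
      simp at this
    simp [this]

lemma cons_zero_mulVec_join {n : ℕ} (p : Fin n → Fin 4) (a b : Bits n → ℂ) :
    pauliString (Fin.cons 0 p : Fin (n + 1) → Fin 4) *ᵥ join a b =
      join (pauliString p *ᵥ a) (pauliString p *ᵥ b) := by
  simp [pauliString_cons_mulVec_join, pauli]

lemma cons_one_mulVec_join {n : ℕ} (p : Fin n → Fin 4) (a b : Bits n → ℂ) :
    pauliString (Fin.cons 1 p : Fin (n + 1) → Fin 4) *ᵥ join a b =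
      join (pauliString p *ᵥ b) (pauliString p *ᵥ a) := by
  simp [pauliString_cons_mulVec_join, pauli]

lemma cons_two_mulVec_join {n : ℕ} (p : Fin n → Fin 4) (a b : Bits n → ℂ) :
    pauliString (Fin.cons 2 p : Fin (n + 1) → Fin 4) *ᵥ join a b =
      join (-I • (pauliString p *ᵥ b)) (I • (pauliString p *ᵥ a)) := by
  simp [pauliString_cons_mulVec_join, pauli]

lemma cons_three_mulVec_join {n : ℕ} (p : Fin n → Fin 4) (a b : Bits n → ℂ) :
    pauliString (Fin.cons 3 p : Fin (n + 1) → Fin 4) *ᵥ join a b =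
      join (pauliString p *ᵥ a) (-(pauliString p *ᵥ b)) := by
  simp [pauliString_cons_mulVec_join, pauli]

lemma pauliString_mulVec_mulVec_self {n : ℕ} (p : Fin n → Fin 4) (a : Bits n → ℂ) :
    pauliString p *ᵥ (pauliString p *ᵥ a) = a := by
  rw [Matrix.mulVec_mulVec, pauliString_mul_self, Matrix.one_mulVec]

lemma IsStab.of_join_zero {n : ℕ} {a : Bits n → ℂ} (h : IsStab (join a 0)) : IsStab a := by
  refine ⟨by simpa [star_join_dotProduct] using h.unit, fun p => ?_⟩
  have := h.eigen (Fin.cons 0 p)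
  rw [cons_zero_mulVec_join, star_join_dotProduct] at this
  simpa [smul_join, join_inj] using this

lemma IsStab.of_zero_join {n : ℕ} {b : Bits n → ℂ} (h : IsStab (join 0 b)) : IsStab b := by
  refine ⟨by simpa [star_join_dotProduct] using h.unit, fun p => ?_⟩
  have := h.eigen (Fin.cons 0 p)
  rw [cons_zero_mulVec_join, star_join_dotProduct] at this
  simpa [smul_join, join_inj] using this

lemma sq_eq_one_of_smul_eq {n : ℕ} {z : ℂ} {v : Bits n → ℂ} (hv : v ≠ 0) (h : v = (z * z) • v) :
    z = 1 ∨ z = -1 := by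
  have h1 : (z * z - 1) • v = 0 := by rw [sub_smul, one_smul, ← h, sub_self]
  rcases smul_eq_zero.1 h1 with h2 | h2
  · exact mul_self_eq_one_iff.1 (sub_eq_zero.1 h2)
  · exact absurd h2 hv

lemma sqrt_two_ne_zero : ((√2 : ℝ) : ℂ) ≠ 0 := by
  simp

/-- The alternatives come from testing with `Z ⊗ 1`. As an eigenvector, the state has a vanishing
half. With zero expectation its halves have equal norm, and testing with `X ⊗ P` and `Y ⊗ P` relates
them. -/
lemma IsStab.join_cases {n : ℕ} {a b : Bits n → ℂ} (h : IsStab (join a b)) :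
    (b = 0 ∧ IsStab a) ∨ (a = 0 ∧ IsStab b) ∨
      ∃ (φ : Bits n → ℂ) (p : Fin n → Fin 4) (k : ℕ), IsStab φ ∧
        a = ((√2 : ℝ) : ℂ)⁻¹ • φ ∧ b = ((√2 : ℝ) : ℂ)⁻¹ • I ^ k • (pauliString p *ᵥ φ) := by
  have hZ := h.eigen (Fin.cons 3 fun _ => 0)
  rw [cons_three_mulVec_join, pauliString_zero, Matrix.one_mulVec, Matrix.one_mulVec,
    star_join_dotProduct] at hZ
  rcases hZ with ⟨c, hc⟩ | hZ
  · rw [smul_join, join_inj] at hc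
    by_cases ha : a = 0
    · subst ha
      exact Or.inr (Or.inl ⟨rfl, h.of_zero_join⟩)
    · left
      have hc1 : c = 1 := by
        have h1 : (c - 1) • a = 0 := by rw [sub_smul, one_smul, ← hc.1, sub_self]
        exact sub_eq_zero.1 ((smul_eq_zero.1 h1).resolve_right ha)
      have hb : b = 0 := by
        have h2 := hc.2
        rw [hc1, one_smul] at h2
        exact neg_eq_self.1 h2
      subst hb
      exact ⟨rfl, h.of_join_zero⟩
  · right; right
    have hu := h.unit
    rw [star_join_dotProduct] at hu
    rw [dotProduct_neg] at hZ
    have haa : star a ⬝ᵥ a = 1 / 2 := by linear_combination (hu + hZ) / 2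
    have hbb : star b ⬝ᵥ b = 1 / 2 := by linear_combination (hu - hZ) / 2
    have ha : a ≠ 0 := by rintro rfl; simp at haa
    have hb : b ≠ 0 := by rintro rfl; simp at hbb
    -- The mean of `1 ⊗ p` and `Z ⊗ p` sees only the first half, so `a` inherits the dichotomy.
    have key : ∀ p, (∃ c : ℂ, pauliString p *ᵥ a = c • a) ∨
        star a ⬝ᵥ (pauliString p *ᵥ a) = 0 := by
      intro p
      have h0 := h.eigen (Fin.cons 0 p)
      have h3 := h.eigen (Fin.cons 3 p)
      rw [cons_zero_mulVec_join, star_join_dotProduct] at h0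
      rw [cons_three_mulVec_join, star_join_dotProduct, dotProduct_neg] at h3
      simp only [smul_join, join_inj] at h0 h3
      rcases h0 with ⟨c, hc, -⟩ | h0
      · exact Or.inl ⟨c, hc⟩
      rcases h3 with ⟨c, hc, -⟩ | h3
      · exact Or.inl ⟨c, hc⟩
      right
      linear_combination (h0 + h3) / 2
    obtain ⟨p, hp⟩ := exists_pauliString_overlap_ne_zero ha hb
    have hpa : pauliString p *ᵥ a ≠ 0 := fun h0 => ha <| by
      rw [← pauliString_mulVec_mulVec_self p a, h0, Matrix.mulVec_zero]
    -- The expectations of `X ⊗ P` and `Y ⊗ P` together determine `a* P b`, which is nonzero. One of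
    -- the two operators therefore has the state as an eigenvector. Its eigenvalue is `±1`, so `b`
    -- is `±Pa` or `±i Pa`.
    obtain ⟨k, hk⟩ : ∃ k : ℕ, b = I ^ k • (pauliString p *ᵥ a) := by
      have h1 := h.eigen (Fin.cons 1 p)
      have h2 := h.eigen (Fin.cons 2 p)
      rw [cons_one_mulVec_join, star_join_dotProduct] at h1
      rw [cons_two_mulVec_join, star_join_dotProduct] at h2
      simp only [smul_join, join_inj] at h1 h2
      rcases h1 with ⟨c, hc1, hc2⟩ | h1
      · have hb' : b = c • (pauliString p *ᵥ a) := by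
          rw [← pauliString_mulVec_mulVec_self p b, hc1, Matrix.mulVec_smul]
        have := hc2
        rw [hb', smul_smul] at this
        rcases sq_eq_one_of_smul_eq hpa this with rfl | rfl
        · exact ⟨0, by simpa using hb'⟩
        · exact ⟨2, by simpa using hb'⟩
      rcases h2 with ⟨c, hc1, hc2⟩ | h2
      · have hb1 : pauliString p *ᵥ b = (I * c) • a := by
          rw [mul_smul, ← hc1, smul_smul]
          simp
        have hb' : b = (I * c) • (pauliString p *ᵥ a) := by
          rw [← pauliString_mulVec_mulVec_self p b, hb1, Matrix.mulVec_smul]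
        have h3 : pauliString p *ᵥ a = (c * c) • (pauliString p *ᵥ a) := by
          have : pauliString p *ᵥ a = (-I) • (I • (pauliString p *ᵥ a)) := by
            rw [smul_smul]; simp
          conv_lhs => rw [this, hc2, hb', smul_smul, smul_smul]
          congr 1
          linear_combination -c * c * I_mul_I
        rcases sq_eq_one_of_smul_eq hpa h3 with rfl | rfl
        · exact ⟨1, by simpa using hb'⟩
        · exact ⟨3, by simpa [pow_succ] using hb'⟩
      · exfalso
        apply hp
        rw [dotProduct_smul, dotProduct_smul, smul_eq_mul, smul_eq_mul] at h2
        linear_combination h1 / 2 + I / 2 * h2 + (star a ⬝ᵥ (pauliString p *ᵥ b) -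
          star b ⬝ᵥ (pauliString p *ᵥ a)) / 2 * I_mul_I
    refine ⟨((√2 : ℝ) : ℂ) • a, p, k, ⟨?_, fun q => ?_⟩, ?_, ?_⟩
    · have h2 : ((√2 : ℝ) : ℂ) * ((√2 : ℝ) : ℂ) = 2 := by
        rw [← ofReal_mul, Real.mul_self_sqrt (by norm_num)]; norm_num
      rw [star_smul, smul_dotProduct, dotProduct_smul, haa]
      simp only [smul_eq_mul, star_def, conj_ofReal]
      linear_combination h2 / 2
    · rcases key q with ⟨c, hc⟩ | hq
      · exact Or.inl ⟨c, by rw [Matrix.mulVec_smul, hc, smul_comm]⟩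
      · right
        rw [Matrix.mulVec_smul, star_smul, smul_dotProduct, dotProduct_smul, hq]
        simp
    · rw [smul_smul, inv_mul_cancel₀ sqrt_two_ne_zero, one_smul]
    · rw [Matrix.mulVec_smul, smul_comm (I ^ k), smul_smul, inv_mul_cancel₀ sqrt_two_ne_zero,
        one_smul, hk]

lemma Reach.join_zero {n : ℕ} {φ : Bits n → ℂ} (h : Reach φ) : Reach (join φ 0) := by
  induction h with
  | basis => rw [← single_zero_succ]; exact .basis
  | smul z ψ hz _ ih =>
    have := ih.smul z _ hz
    rwa [smul_join, smul_zero] at this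
  | pauli p ψ _ ih =>
    have := ih.pauli (Fin.cons 0 p)
    rwa [cons_zero_mulVec_join, Matrix.mulVec_zero] at this
  | rotate p ψ _ ih =>
    have := ih.rotate (Fin.cons 0 p)
    rwa [pauliRotation_mulVec, cons_zero_mulVec_join, Matrix.mulVec_zero, smul_join, join_add,
      smul_join, smul_zero, add_zero, smul_zero, ← pauliRotation_mulVec] at this

lemma Reach.zero_join {n : ℕ} {φ : Bits n → ℂ} (h : Reach φ) : Reach (join 0 φ) := by
  have := h.join_zero.pauli (Fin.cons 1 fun _ => 0)
  rwa [cons_one_mulVec_join, pauliString_zero, Matrix.one_mulVec, Matrix.one_mulVec] at this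

lemma Reach.flip {n : ℕ} {a b : Bits n → ℂ} (h : Reach (join a b)) : Reach (join a (-b)) := by
  have := h.pauli (Fin.cons 3 fun _ => 0)
  rwa [cons_three_mulVec_join, pauliString_zero, Matrix.one_mulVec, Matrix.one_mulVec] at this

/-- Rotating `|0⟩φ` about `X ⊗ P` gives `k = 1` and about `Y ⊗ P` gives `k = 2`. A `Z` on the first
qubit negates the second half and supplies `k = 3` and `k = 0`. -/
lemma Reach.superpose {n : ℕ} {φ : Bits n → ℂ} (h : Reach φ) (p : Fin n → Fin 4) (k : ℕ) :
    Reach (join (((√2 : ℝ) : ℂ)⁻¹ • φ) (((√2 : ℝ) : ℂ)⁻¹ • I ^ k • (pauliString p *ᵥ φ))) := by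
  have hX := h.join_zero.rotate (Fin.cons 1 p)
  rw [pauliRotation_mulVec, cons_one_mulVec_join, Matrix.mulVec_zero, smul_join, join_add,
    smul_join, smul_zero, add_zero, zero_add] at hX
  have hY := h.join_zero.rotate (Fin.cons 2 p)
  rw [pauliRotation_mulVec, cons_two_mulVec_join, Matrix.mulVec_zero, smul_join, join_add,
    smul_join, smul_zero, smul_zero, add_zero, zero_add, smul_smul I, I_mul_I, neg_smul,
    one_smul] at hY
  obtain ⟨j, hj⟩ := I_pow_fin k
  rw [hj]
  fin_cases j
  · simpa using hY.flip
  · simpa using hX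
  · simpa using hY
  · simpa [pow_succ] using hX.flip

/-- Induction on the number of qubits: every alternative of `IsStab.join_cases` can be prepared from
a reachable smaller vector. With no qubits only a phase remains. -/
lemma IsStab.reach {n : ℕ} {ψ : Bits n → ℂ} (h : IsStab ψ) : Reach ψ := by
  induction n with
  | zero =>
    have hψ : ψ = ψ 0 • Pi.single 0 1 := by
      ext x
      rw [Subsingleton.elim x 0]
      simp
    rw [hψ]
    refine Reach.basis.smul _ _ ?_
    have hu := h.unit
    rwa [dotProduct, Fintype.sum_eq_single 0 fun x hx => absurd (Subsingleton.elim x 0) hx] at hu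
  | succ n ih =>
    rw [join_eta ψ] at h ⊢
    rcases h.join_cases with ⟨hb, ha⟩ | ⟨ha, hb⟩ | ⟨φ, p, k, hφ, ha, hb⟩
    · rw [hb]; exact (ih ha).join_zero
    · rw [ha]; exact (ih hb).zero_join
    · rw [ha, hb]; exact (ih hφ).superpose p k

lemma isStab_clifford {n : ℕ} {U : QubitUnitary n} (hU : U ∈ cliffordUnitaries n) :
    IsStab ((U : Matrix (Bits n) (Bits n) ℂ) *ᵥ Pi.single 0 1) :=
  (isStab_single n).clifford hU

lemma Reach.isStab {n : ℕ} {ψ : Bits n → ℂ} (h : Reach ψ) : IsStab ψ := by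
  obtain ⟨U, hU, rfl⟩ := h.exists_clifford
  exact isStab_clifford hU

/-! ### Rays of stabilizer states -/

/-- The rank-one matrix `|ψ⟩⟨ψ|`. -/
def density {n : ℕ} (ψ : Bits n → ℂ) : Matrix (Bits n) (Bits n) ℂ :=
  vecMulVec ψ (star ψ)

lemma density_mulVec {n : ℕ} (A : Matrix (Bits n) (Bits n) ℂ) (ψ : Bits n → ℂ) :
    density (A *ᵥ ψ) = A * density ψ * star A := by
  rw [density, density, Matrix.star_mulVec, Matrix.mul_vecMulVec, Matrix.vecMulVec_mul]
  rfl

lemma density_apply {n : ℕ} (ψ : Bits n → ℂ) (x y : Bits n) :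
    density ψ x y = ψ x * star (ψ y) := rfl

lemma density_smul {n : ℕ} {z : ℂ} (hz : star z * z = 1) (ψ : Bits n → ℂ) :
    density (z • ψ) = density ψ := by
  ext x y
  simp only [density_apply, Pi.smul_apply, smul_eq_mul, star_mul']
  linear_combination (ψ x * star (ψ y)) * hz

lemma density_mulVec_self {n : ℕ} (ψ φ : Bits n → ℂ) :
    density ψ *ᵥ φ = (star ψ ⬝ᵥ φ) • ψ := by
  rw [density, Matrix.vecMulVec_mulVec]
  ext x
  simp [mul_comm]

/-- Applying both projections to `ψ` shows that `ψ` is a multiple of `φ`; normalization makes the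
factor a phase. -/
lemma exists_phase_of_density_eq {n : ℕ} {ψ φ : Bits n → ℂ} (hψ : star ψ ⬝ᵥ ψ = 1)
    (hφ : star φ ⬝ᵥ φ = 1) (h : density ψ = density φ) :
    ∃ z : ℂ, star z * z = 1 ∧ ψ = z • φ := by
  have h1 : ψ = (star φ ⬝ᵥ ψ) • φ := by
    rw [← density_mulVec_self, ← h, density_mulVec_self, hψ, one_smul]
  refine ⟨_, ?_, h1⟩
  generalize star φ ⬝ᵥ ψ = z at h1
  rw [h1, star_smul, smul_dotProduct, dotProduct_smul, hφ] at hψ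
  simpa using hψ

/-- The rays of stabilizer states. -/
def stabSet (n : ℕ) : Set (Matrix (Bits n) (Bits n) ℂ) := density '' {ψ | IsStab ψ}

/-- The matrices with constant diagonal `1 / 2 ^ n`. -/
def HasUniformDiag {n : ℕ} (ρ : Matrix (Bits n) (Bits n) ℂ) : Prop :=
  ∀ x, ρ x x = 1 / 2 ^ n

lemma exists_rep {n : ℕ} (ρ : stabSet n) : ∃ U : QubitUnitary n, U ∈ cliffordUnitaries n ∧
    density ((U : Matrix (Bits n) (Bits n) ℂ) *ᵥ Pi.single 0 1) = ρ := by
  obtain ⟨_, ψ, hψ, rfl⟩ := ρ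
  obtain ⟨U, hU, rfl⟩ := (IsStab.reach hψ).exists_clifford
  exact ⟨U, hU, rfl⟩

/-- A Clifford unitary preparing a given stabilizer state. -/
def rep {n : ℕ} (ρ : stabSet n) : QubitUnitary n := (exists_rep ρ).choose

lemma rep_mem {n : ℕ} (ρ : stabSet n) : rep ρ ∈ cliffordUnitaries n :=
  (exists_rep ρ).choose_spec.1

lemma density_rep {n : ℕ} (ρ : stabSet n) :
    density ((rep ρ : Matrix (Bits n) (Bits n) ℂ) *ᵥ Pi.single 0 1) = ρ :=
  (exists_rep ρ).choose_spec.2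

/-! ### Extending a stabilizer state by one qubit -/

/-- The column `U |x⟩`. -/
def col {n : ℕ} (U : QubitUnitary n) (x : Bits n) : Bits n → ℂ :=
  (U : Matrix (Bits n) (Bits n) ℂ) *ᵥ Pi.single x 1

lemma star_col_dotProduct_col {n : ℕ} (U : QubitUnitary n) (x : Bits n) :
    star (col U x) ⬝ᵥ col U x = 1 := by
  rw [col, star_dotProduct_unitary]
  simp

lemma col_ne_zero {n : ℕ} (U : QubitUnitary n) (x : Bits n) : col U x ≠ 0 := fun h => by
  have := star_col_dotProduct_col U x
  simp [h] at this

/-- Together with `exists_eq_col`, this replaces the Pauli images of `U|0⟩` by the columns of `U`.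
Different Pauli strings may give the same image up to phase, whereas the columns are orthonormal, so
indexing by columns avoids double counting. -/
lemma exists_col_eq {n : ℕ} {U : QubitUnitary n} (hU : U ∈ cliffordUnitaries n) (x : Bits n) :
    ∃ (k : ℕ) (p : Fin n → Fin 4), col U x = I ^ k • (pauliString p *ᵥ col U 0) := by
  obtain ⟨q, hq⟩ := exists_pauliString_mulVec_single x
  obtain ⟨k, p, h⟩ := clifford_conj hU q
  refine ⟨k, p, ?_⟩
  rw [col, col, ← hq, Matrix.mulVec_mulVec, h, Matrix.smul_mulVec, Matrix.mulVec_mulVec]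

lemma exists_eq_col {n : ℕ} {U : QubitUnitary n} (hU : U ∈ cliffordUnitaries n)
    (p : Fin n → Fin 4) :
    ∃ (k : ℕ) (x : Bits n), pauliString p *ᵥ col U 0 = I ^ k • col U x := by
  obtain ⟨k, q, h⟩ := clifford_conj' hU p
  obtain ⟨l, x, hx⟩ := pauliString_mulVec_single q 0
  refine ⟨k + l, x, ?_⟩
  rw [col, col, Matrix.mulVec_mulVec, h, Matrix.smul_mulVec, ← Matrix.mulVec_mulVec, hx,
    Matrix.mulVec_smul, smul_smul, pow_add]

lemma I_pow_injective : Function.Injective fun k : Fin 4 => I ^ (k : ℕ) := by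
  intro j k h
  fin_cases j <;> fin_cases k <;> simp [pow_succ, Complex.ext_iff] at h ⊢ <;> norm_num at h

lemma I_pow_smul_col_injective {n : ℕ} {U : QubitUnitary n} {x y : Bits n} {j k : Fin 4}
    (h : I ^ (j : ℕ) • col U x = I ^ (k : ℕ) • col U y) : x = y ∧ j = k := by
  have h1 : I ^ (j : ℕ) • (Pi.single x 1 : Bits n → ℂ) = I ^ (k : ℕ) • Pi.single y 1 := by
    have := congrArg (fun v => star (U : Matrix (Bits n) (Bits n) ℂ) *ᵥ v) h
    simpa only [col, ← Matrix.mulVec_smul, Matrix.mulVec_mulVec,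
      Matrix.UnitaryGroup.star_mul_self, Matrix.one_mulVec] using this
  have hx := congrFun h1 x
  have hxy : x = y := by
    by_contra hne
    simp [hne] at hx
  subst hxy
  exact ⟨rfl, I_pow_injective (by simpa using hx)⟩

/-- The stabilizer states on `n + 1` qubits that restrict to `U |0⟩`. -/
def branch {n : ℕ} (U : QubitUnitary n) : Bool ⊕ (Bits n × Fin 4) → Bits (n + 1) → ℂ
  | .inl false => join (col U 0) 0
  | .inl true => join 0 (col U 0)
  | .inr (x, k) => join (((√2 : ℝ) : ℂ)⁻¹ • col U 0) (((√2 : ℝ) : ℂ)⁻¹ • I ^ (k : ℕ) • col U x)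

lemma isStab_branch {n : ℕ} {U : QubitUnitary n} (hU : U ∈ cliffordUnitaries n)
    (c : Bool ⊕ (Bits n × Fin 4)) : IsStab (branch U c) := by
  have hR : Reach (col U 0) := (isStab_clifford hU).reach
  refine Reach.isStab ?_
  rcases c with (_ | _) | ⟨x, k⟩
  · exact hR.join_zero
  · exact hR.zero_join
  · obtain ⟨l, p, h⟩ := exists_col_eq hU x
    simp only [branch]
    rw [h, smul_smul (I ^ (k : ℕ)), ← pow_add]
    exact hR.superpose p _

lemma inv_sqrt_two_ne_zero : ((√2 : ℝ) : ℂ)⁻¹ ≠ 0 := inv_ne_zero sqrt_two_ne_zero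

lemma ne_zero_of_phase {z : ℂ} (hz : star z * z = 1) : z ≠ 0 := by
  rintro rfl
  simp at hz

/-- The position of a zero half separates the kinds of extension; in each kind a nonzero half
recovers the ray. -/
lemma branch_injective {n : ℕ} {ρ σ : stabSet n} {c d : Bool ⊕ (Bits n × Fin 4)}
    (h : density (branch (rep ρ) c) = density (branch (rep σ) d)) : ρ = σ ∧ c = d := by
  obtain ⟨z, hz, h⟩ := exists_phase_of_density_eq (isStab_branch (rep_mem ρ) c).unit
    (isStab_branch (rep_mem σ) d).unit h
  have hz0 := ne_zero_of_phase hz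
  have key : col (rep ρ) 0 = z • col (rep σ) 0 → ρ = σ := by
    intro h
    ext1
    rw [← density_rep ρ, ← density_rep σ]
    change density (col _ _) = density (col _ _)
    rw [h, density_smul hz]
  rcases c with (_ | _) | ⟨x, k⟩ <;> rcases d with (_ | _) | ⟨y, l⟩ <;>
    simp only [branch, smul_join, join_inj, smul_zero] at h
  · exact ⟨key h.1, rfl⟩
  · exact absurd h.1 (col_ne_zero _ _)
  · exact absurd h.2.symm (by simp [hz0, col_ne_zero])
  · exact absurd h.2 (col_ne_zero _ _)
  · exact ⟨key h.2, rfl⟩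
  · exact absurd h.1.symm (by simp [hz0, col_ne_zero])
  · exact absurd h.2 (by simp [col_ne_zero])
  · exact absurd h.1 (by simp [col_ne_zero])
  · have h1 : col (rep ρ) 0 = z • col (rep σ) 0 := by
      refine smul_right_injective _ inv_sqrt_two_ne_zero ?_
      simpa only [smul_comm z] using h.1
    have h2 : I ^ (k : ℕ) • col (rep ρ) x = z • I ^ (l : ℕ) • col (rep σ) y := by
      refine smul_right_injective _ inv_sqrt_two_ne_zero ?_
      simpa only [smul_comm z] using h.2
    obtain rfl := key h1
    -- Equal rays share the same chosen `rep`, so comparing the first halves pins the global phase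
    -- to `1`. The second halves then determine the column and the power of `i`.
    have hz1 : z = 1 := by
      have h3 : (z - 1) • col (rep ρ) 0 = 0 := by rw [sub_smul, one_smul, ← h1, sub_self]
      exact sub_eq_zero.1 ((smul_eq_zero.1 h3).resolve_right (col_ne_zero _ _))
    rw [hz1, one_smul] at h2
    obtain ⟨rfl, rfl⟩ := I_pow_smul_col_injective h2
    exact ⟨rfl, rfl⟩

lemma exists_phase_rep {n : ℕ} {φ : Bits n → ℂ} (hφ : IsStab φ) :
    ∃ (ρ : stabSet n) (z : ℂ), star z * z = 1 ∧ φ = z • col (rep ρ) 0 := by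
  let ρ : stabSet n := ⟨density φ, φ, hφ, rfl⟩
  exact ⟨ρ, exists_phase_of_density_eq hφ.unit (star_col_dotProduct_col _ _)
    (density_rep ρ).symm⟩

/-- The phase between `φ` and the chosen representative of its ray factors out of both halves at
once, so it disappears in `density`. -/
lemma branch_surjective {n : ℕ} {ψ : Bits (n + 1) → ℂ} (h : IsStab ψ) :
    ∃ (ρ : stabSet n) (c : Bool ⊕ (Bits n × Fin 4)), density (branch (rep ρ) c) = density ψ := by
  rw [join_eta ψ] at h ⊢
  rcases h.join_cases with ⟨hb, ha⟩ | ⟨ha, hb⟩ | ⟨φ, p, k, hφ, ha, hb⟩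
  · obtain ⟨ρ, z, hz, h⟩ := exists_phase_rep ha
    refine ⟨ρ, .inl false, ?_⟩
    rw [hb, h, ← smul_zero (A := Bits n → ℂ) z, ← smul_join, density_smul hz]
    rfl
  · obtain ⟨ρ, z, hz, h⟩ := exists_phase_rep hb
    refine ⟨ρ, .inl true, ?_⟩
    rw [ha, h, ← smul_zero (A := Bits n → ℂ) z, ← smul_join, density_smul hz]
    rfl
  · obtain ⟨ρ, z, hz, h⟩ := exists_phase_rep hφ
    obtain ⟨l, x, hx⟩ := exists_eq_col (rep_mem ρ) p
    obtain ⟨j, hj⟩ := I_pow_fin (k + l)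
    refine ⟨ρ, .inr (x, j), ?_⟩
    rw [ha, hb, h, Matrix.mulVec_smul, hx, smul_comm (I ^ k) z, smul_comm _ z, smul_comm _ z,
      ← smul_join, density_smul hz, smul_smul (I ^ k), ← pow_add, hj]
    rfl

/-! ### Uniformity of the output distribution -/

lemma HasUniformDiag.pauli {n : ℕ} {ψ : Bits n → ℂ} (h : HasUniformDiag (density ψ))
    (p : Fin n → Fin 4) : HasUniformDiag (density (pauliString p *ᵥ ψ)) := by
  intro x
  obtain ⟨k, y, hy⟩ := pauliString_mulVec_single p x
  have hx : (pauliString p *ᵥ ψ) x = star (I ^ k) * ψ y := by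
    -- Self-adjointness moves the string onto the basis vector, where it acts by a permutation and a
    -- phase.
    have h1 : (pauliString p *ᵥ ψ) x = star (pauliString p *ᵥ Pi.single x 1) ⬝ᵥ ψ := by
      rw [Matrix.star_mulVec, ← star_eq_conjTranspose, pauliString_star,
        ← Matrix.dotProduct_mulVec]
      simp
    rw [h1, hy]
    simp
  have hI : star (I ^ k) * I ^ k = 1 := by
    rw [star_pow, ← mul_pow]; simp
  rw [density_apply, hx, star_mul', star_star, ← h y, density_apply]
  linear_combination (ψ y * star (ψ y)) * hI

lemma HasUniformDiag.smul_iff {n : ℕ} {z : ℂ} (hz : star z * z = 1) {ψ : Bits n → ℂ} :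
    HasUniformDiag (density (z • ψ)) ↔ HasUniformDiag (density ψ) := by
  rw [density_smul hz]

lemma hasUniformDiag_join {n : ℕ} (a b : Bits n → ℂ) :
    HasUniformDiag (density (join (((√2 : ℝ) : ℂ)⁻¹ • a) (((√2 : ℝ) : ℂ)⁻¹ • b))) ↔
      HasUniformDiag (density a) ∧ HasUniformDiag (density b) := by
  have hs : ((√2 : ℝ) : ℂ)⁻¹ * star ((√2 : ℝ) : ℂ)⁻¹ = 1 / 2 := by
    rw [← inv_sqrt_two_mul_self]; simp
  have key : ∀ c : ℂ, (((√2 : ℝ) : ℂ)⁻¹ * c) * star (((√2 : ℝ) : ℂ)⁻¹ * c) = 1 / 2 ^ (n + 1) ↔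
      c * star c = 1 / 2 ^ n := by
    intro c
    have : (((√2 : ℝ) : ℂ)⁻¹ * c) * star (((√2 : ℝ) : ℂ)⁻¹ * c) = 1 / 2 * (c * star c) := by
      rw [star_mul', ← hs]; ring
    rw [this, show (1 : ℂ) / 2 ^ (n + 1) = 1 / 2 * (1 / 2 ^ n) by rw [pow_succ]; field_simp]
    exact mul_right_inj' (by norm_num)
  unfold HasUniformDiag
  rw [forall_bits_succ]
  simp only [density_apply, join_cons_zero, join_cons_one, Pi.smul_apply, smul_eq_mul, key]

/-- A zero half excludes uniformity. In a superposition the second half is a Pauli image of the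
first up to phase, so it is uniform as soon as the first is. -/
lemma hasUniformDiag_branch {n : ℕ} (ρ : stabSet n) (c : Bool ⊕ (Bits n × Fin 4)) :
    HasUniformDiag (density (branch (rep ρ) c)) ↔ HasUniformDiag (ρ : Matrix (Bits n) (Bits n) ℂ) ∧
      ∃ d, c = .inr d := by
  rcases c with (_ | _) | ⟨x, k⟩
  · simp only [reduceCtorEq, exists_false, and_false, iff_false]
    intro h
    have := h (Fin.cons 1 0)
    simp [density_apply, branch] at this
    exact pow_ne_zero (n + 1) two_ne_zero this.symm
  · simp only [reduceCtorEq, exists_false, and_false, iff_false]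
    intro h
    have := h (Fin.cons 0 0)
    simp [density_apply, branch] at this
    exact pow_ne_zero (n + 1) two_ne_zero this.symm
  · simp only [branch, hasUniformDiag_join, Sum.inr.injEq, exists_eq', and_true]
    rw [col, density_rep, and_iff_left_iff_imp, ← density_rep]
    intro h
    obtain ⟨l, p, hp⟩ := exists_col_eq (rep_mem ρ) x
    have hI : ∀ k, star (I ^ k) * I ^ k = 1 := fun k => by rw [star_pow, ← mul_pow]; simp
    rw [HasUniformDiag.smul_iff (hI _), hp, HasUniformDiag.smul_iff (hI _)]
    exact HasUniformDiag.pauli h p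

/-! ### Counting rays -/

/-- The rays of stabilizer states with uniform Born distribution. -/
def unifSet (n : ℕ) : Set (Matrix (Bits n) (Bits n) ℂ) := {ρ ∈ stabSet n | HasUniformDiag ρ}

lemma card_stabSet_succ (n : ℕ) :
    Nat.card (stabSet (n + 1)) = Nat.card (stabSet n) * (2 + 2 ^ n * 4) := by
  have : Function.Bijective (fun rc : stabSet n × (Bool ⊕ (Bits n × Fin 4)) =>
      (⟨density (branch (rep rc.1) rc.2), _, isStab_branch (rep_mem rc.1) rc.2, rfl⟩ :
        stabSet (n + 1))) := by
    constructor
    · rintro ⟨ρ, c⟩ ⟨σ, d⟩ h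
      exact Prod.ext_iff.2 (branch_injective (Subtype.ext_iff.1 h))
    · rintro ⟨_, ψ, hψ, rfl⟩
      obtain ⟨ρ, c, h⟩ := branch_surjective hψ
      exact ⟨(ρ, c), Subtype.ext h⟩
  rw [← Nat.card_eq_of_bijective _ this, Nat.card_prod]
  simp

lemma card_unifSet_succ (n : ℕ) :
    Nat.card (unifSet (n + 1)) = Nat.card (unifSet n) * (2 ^ n * 4) := by
  have : Function.Bijective (fun rc : unifSet n × (Bits n × Fin 4) =>
      (⟨density (branch (rep ⟨rc.1, rc.1.2.1⟩) (.inr rc.2)),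
        ⟨_, isStab_branch (rep_mem _) _, rfl⟩,
        (hasUniformDiag_branch _ _).2 ⟨rc.1.2.2, _, rfl⟩⟩ : unifSet (n + 1))) := by
    constructor
    · rintro ⟨ρ, c⟩ ⟨σ, d⟩ h
      obtain ⟨h1, h2⟩ := branch_injective (Subtype.ext_iff.1 h)
      exact Prod.ext_iff.2 ⟨Subtype.ext (by simpa using h1), Sum.inr_injective h2⟩
    · rintro ⟨_, ⟨ψ, hψ, rfl⟩, hu⟩
      obtain ⟨ρ, c, h⟩ := branch_surjective hψ
      rw [← h, hasUniformDiag_branch] at hu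
      obtain ⟨hρ, d, rfl⟩ := hu
      exact ⟨(⟨ρ, ρ.2, hρ⟩, d), Subtype.ext h⟩
  rw [← Nat.card_eq_of_bijective _ this, Nat.card_prod]
  simp

lemma stabSet_zero : stabSet 0 = {1} := by
  ext ρ
  constructor
  · rintro ⟨ψ, hψ, rfl⟩
    have hu := hψ.unit
    rw [dotProduct, Fintype.sum_eq_single 0 fun x hx => absurd (Subsingleton.elim x 0) hx,
      mul_comm] at hu
    ext x y
    rw [Subsingleton.elim y x, Subsingleton.elim x 0, Matrix.one_apply_eq]
    exact hu
  · rintro rfl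
    refine ⟨_, isStab_single 0, ?_⟩
    ext x y
    rw [Subsingleton.elim y 0, Subsingleton.elim x 0]
    simp [density_apply]

lemma unifSet_zero : unifSet 0 = {1} := by
  rw [unifSet, stabSet_zero]
  ext ρ
  simp only [Set.mem_singleton_iff, Set.mem_ofPred_eq, and_iff_left_iff_imp]
  rintro rfl x
  simp

lemma card_stabSet_pos (n : ℕ) : 0 < Nat.card (stabSet n) := by
  induction n with
  | zero => simp [stabSet_zero]
  | succ n ih => rw [card_stabSet_succ]; positivity

/-- The induction step is the identity `(2 + 4·2^n) / (4·2^n) = 1 + 1/2^(n+1)`. -/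
lemma card_unifSet_div_card_stabSet (n : ℕ) :
    (Nat.card (unifSet n) : ℝ) / Nat.card (stabSet n) =
      1 / ∏ i ∈ Finset.Icc 1 n, (1 + 1 / (2 : ℝ) ^ i) := by
  induction n with
  | zero => simp [stabSet_zero, unifSet_zero]
  | succ n ih =>
    rw [Finset.prod_Icc_succ_top (by omega), ← div_div, ← ih, card_stabSet_succ,
      card_unifSet_succ]
    have := card_stabSet_pos n
    push_cast
    field_simp
    ring

/-! ### From rays to the Clifford group -/

/-- All fibres of an equivariant map out of a transitive action have the same size. -/
lemma card_preimage_eq_mul {G α β : Type*} [Group G] [MulAction G α] [MulAction.IsPretransitive G α]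
    {f : α → β} (hf : ∀ (g : G) (a b : α), f a = f b → f (g • a) = f (g • b)) (a₀ : α)
    {T : Set β} (hT : T ⊆ Set.range f) :
    Nat.card (f ⁻¹' T) = Nat.card T * Nat.card {a | f a = f a₀} := by
  have hg : ∀ t : T, ∃ g : G, f (g • a₀) = t := fun t => by
    obtain ⟨a, ha⟩ := hT t.2
    obtain ⟨g, rfl⟩ := MulAction.exists_smul_eq G a₀ a
    exact ⟨g, ha⟩
  choose g hg using hg
  rw [← Nat.card_prod]
  -- For each `t` in `T` a group element carrying `a₀` into the fibre over `t` has been chosen; its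
  -- inverse translates that fibre back onto the fibre of `a₀`.
  refine Nat.card_congr
    { toFun := fun a => (⟨f a, a.2⟩, ⟨(g ⟨f a, a.2⟩)⁻¹ • (a : α), ?_⟩)
      invFun := fun tb => ⟨g tb.1 • (tb.2 : α), ?_⟩
      left_inv := ?_
      right_inv := ?_ }
  · have := hf (g ⟨f a, a.2⟩)⁻¹ a (g ⟨f a, a.2⟩ • a₀) (hg ⟨f a, a.2⟩).symm
    simpa using this
  · have h : f (g tb.1 • (tb.2 : α)) = tb.1 := (hf _ _ _ tb.2.2).trans (hg _)
    rw [Set.mem_preimage, h]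
    exact tb.1.2
  · rintro ⟨a, ha⟩
    simp
  · rintro ⟨t, b, hb⟩
    have h : f (g t • b) = t := (hf _ _ _ hb).trans (hg _)
    have ht : (⟨f (g t • b), by rw [h]; exact t.2⟩ : T) = t := Subtype.ext h
    refine Prod.ext ht (Subtype.ext ?_)
    simp [ht]

lemma mem_phases_of_commute {n : ℕ} {W : QubitUnitary n}
    (h : ∀ P ∈ pauliGroup n, W * P = P * W) : W ∈ phases n := by
  obtain ⟨z, hz⟩ := eq_smul_one_of_commute (M := (W : Matrix (Bits n) (Bits n) ℂ)) fun p =>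
    congrArg Subtype.val (h _ (pauliUnitary_mem p))
  have h1 := Matrix.UnitaryGroup.star_mul_self W
  rw [hz, star_smul, star_one, Matrix.smul_mul, Matrix.mul_smul, smul_smul, Matrix.one_mul] at h1
  have h2 : star z * z = 1 := by
    have := congrFun (congrFun h1 0) 0
    simpa using this
  have h3 : ‖z‖ = 1 := by
    have : ‖star z * z‖ = 1 := by rw [h2]; simp
    rw [norm_mul, norm_star] at this
    nlinarith [norm_nonneg z]
  exact ⟨⟨z, mem_sphere_zero_iff_norm.2 h3⟩, hz⟩

/-- A class is determined by its conjugation map on the finite Pauli group: if two representatives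
conjugate alike, their quotient commutes with every Pauli and hence is a phase. -/
instance finite_clifford (n : ℕ) : Finite (Clifford n) := by
  let F : Clifford n → pauliGroup n → pauliGroup n := fun q P =>
    ⟨(q.out : QubitUnitary n) * P * (q.out : QubitUnitary n)⁻¹,
      (Subgroup.mem_normalizer_iff.1 q.out.2 _).1 P.2⟩
  refine Finite.of_injective F fun q r h => ?_
  rw [← QuotientGroup.out_eq' q, ← QuotientGroup.out_eq' r, QuotientGroup.eq,
    Subgroup.mem_subgroupOf]
  refine mem_phases_of_commute fun P hP => ?_
  have h1 : (q.out : QubitUnitary n) * P * (q.out : QubitUnitary n)⁻¹ =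
      (r.out : QubitUnitary n) * P * (r.out : QubitUnitary n)⁻¹ :=
    congrArg Subtype.val (congrFun h ⟨P, hP⟩)
  push_cast
  rw [mul_inv_eq_iff_eq_mul] at h1
  calc _ = (q.out : QubitUnitary n)⁻¹ * ((r.out : QubitUnitary n) * P *
        (r.out : QubitUnitary n)⁻¹ * q.out) * ((q.out : QubitUnitary n)⁻¹ * r.out) := by group
    _ = _ := by rw [← h1]; group

/-- The ray `U |0⋯0⟩` prepared by an element of the Clifford group. -/
def Clifford.ray {n : ℕ} : Clifford n → Matrix (Bits n) (Bits n) ℂ :=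
  Quotient.lift (fun U : cliffordUnitaries n => density (col (U : QubitUnitary n) 0)) (by
    intro U V h
    obtain ⟨z, hz⟩ := Subgroup.mem_subgroupOf.1 (QuotientGroup.leftRel_apply.1 h)
    have hV : (V : QubitUnitary n) = U * ((U⁻¹ * V : cliffordUnitaries n) : QubitUnitary n) := by
      simp
    have hz1 : star (z : ℂ) * z = 1 := by
      rw [star_def, Complex.conj_mul', Circle.norm_coe]; simp
    change density (col _ 0) = density (col _ 0)
    rw [hV, col, col, Matrix.UnitaryGroup.mul_val, hz,
      Matrix.mul_smul, Matrix.mul_one, Matrix.smul_mulVec, density_smul hz1])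

lemma Clifford.ray_mk {n : ℕ} (U : cliffordUnitaries n) :
    Clifford.ray (QuotientGroup.mk U : Clifford n) = density (col (U : QubitUnitary n) 0) := rfl

instance Clifford.mulAction (n : ℕ) : MulAction (cliffordUnitaries n) (Clifford n) :=
  MulAction.quotient _ ((phases n).subgroupOf (cliffordUnitaries n))

instance Clifford.isPretransitive (n : ℕ) :
    MulAction.IsPretransitive (cliffordUnitaries n) (Clifford n) :=
  MulAction.isPretransitive_quotient _ ((phases n).subgroupOf (cliffordUnitaries n))

/-- The new ray depends on `q` only through its old ray, which is the compatibility that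
`card_preimage_eq_mul` requires. -/
lemma Clifford.ray_smul {n : ℕ} (U : cliffordUnitaries n) (q : Clifford n) :
    Clifford.ray (U • q) = ((U : QubitUnitary n) : Matrix (Bits n) (Bits n) ℂ) * q.ray *
      star ((U : QubitUnitary n) : Matrix (Bits n) (Bits n) ℂ) := by
  induction q using QuotientGroup.induction_on with
  | H V =>
    rw [Clifford.ray_mk, ← density_mulVec, col, Matrix.mulVec_mulVec]
    rfl

lemma Clifford.range_ray (n : ℕ) : Set.range (Clifford.ray (n := n)) = stabSet n := by
  ext ρ
  constructor
  · rintro ⟨q, rfl⟩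
    induction q using QuotientGroup.induction_on with
    | H V => exact ⟨_, isStab_clifford V.2, rfl⟩
  · intro hρ
    exact ⟨QuotientGroup.mk ⟨rep ⟨ρ, hρ⟩, rep_mem _⟩, density_rep ⟨ρ, hρ⟩⟩

lemma Clifford.born_eq_uniformDist_iff {n : ℕ} (q : Clifford n) :
    q.born = uniformDist n ↔ q.ray ∈ unifSet n := by
  have h : q.ray ∈ stabSet n := by rw [← Clifford.range_ray]; exact ⟨q, rfl⟩
  rw [unifSet, Set.mem_sep_iff, and_iff_right h]
  induction q using QuotientGroup.induction_on with
  | H V =>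
    rw [funext_iff]
    refine forall_congr' fun x => ?_
    change ‖((V : QubitUnitary n) : Matrix (Bits n) (Bits n) ℂ) x 0‖ ^ 2 = 1 / 2 ^ n ↔ _
    rw [Clifford.ray_mk, density_apply, col, Matrix.mulVec_single_one, Matrix.col_apply,
      star_def, Complex.mul_conj', ← ofReal_inj]
    push_cast
    rfl

lemma card_clifford_preimage {n : ℕ} {T : Set (Matrix (Bits n) (Bits n) ℂ)} (hT : T ⊆ stabSet n) :
    Nat.card (Clifford.ray ⁻¹' T) =
      Nat.card T * Nat.card {q : Clifford n | q.ray = Clifford.ray (QuotientGroup.mk 1)} := by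
  refine card_preimage_eq_mul (G := cliffordUnitaries n) (fun U a b h => ?_) _ ?_
  · rw [Clifford.ray_smul, Clifford.ray_smul, h]
  · rwa [Clifford.range_ray]

lemma probUniform_eq_div (n : ℕ) :
    probUniform n = (Nat.card (unifSet n) : ℝ) / Nat.card (stabSet n) := by
  have : Fintype (Clifford n) := Fintype.ofFinite _
  have : MeasurableSingletonClass (Clifford n) := ⟨fun _ => trivial⟩
  have hset : {U : Clifford n | U.born = uniformDist n} = Clifford.ray ⁻¹' unifSet n :=
    Set.ext Clifford.born_eq_uniformDist_iff
  have huniv : (Set.univ : Set (Clifford n)) = Clifford.ray ⁻¹' stabSet n := by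
    rw [← Clifford.range_ray, Set.preimage_range]
  have h1 := card_clifford_preimage (n := n) (T := unifSet n) fun _ h => h.1
  have h2 := card_clifford_preimage (n := n) (T := stabSet n) subset_rfl
  rw [← huniv, Nat.card_univ] at h2
  have hpos : 0 < Nat.card {q : Clifford n | q.ray = Clifford.ray (QuotientGroup.mk 1)} := by
    have : Nonempty {q : Clifford n | q.ray = Clifford.ray (QuotientGroup.mk 1)} := ⟨⟨_, rfl⟩⟩
    exact Nat.card_pos
  rw [probUniform, MeasureTheory.measureReal_def, ProbabilityTheory.uniformOn_univ, hset,
    MeasureTheory.Measure.count_apply_finite _ (Set.toFinite _), ENNReal.toReal_div,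
    ← Nat.card_eq_fintype_card, h2, ← Set.ncard_eq_toFinset_card, ← Nat.card_coe_set_eq, h1]
  have := card_stabSet_pos n
  simp only [ENNReal.toReal_natCast]
  push_cast
  field_simp

lemma probUniform_eq (n : ℕ) :
    probUniform n = 1 / ∏ i ∈ Finset.Icc 1 n, (1 + 1 / (2 : ℝ) ^ i) := by
  rw [probUniform_eq_div, card_unifSet_div_card_stabSet]

/-! ### The limit and its numerical value -/

/-- The partial products `∏_{i=1}^n (1 + 2^{-i})`. -/
def partialProd (n : ℕ) : ℝ := ∏ i ∈ Finset.Icc 1 n, (1 + 1 / (2 : ℝ) ^ i)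

lemma partialProd_succ (n : ℕ) :
    partialProd (n + 1) = partialProd n * (1 + 1 / (2 : ℝ) ^ (n + 1)) :=
  Finset.prod_Icc_succ_top (by omega) _

lemma partialProd_pos (n : ℕ) : 0 < partialProd n :=
  Finset.prod_pos fun i _ => by positivity

lemma partialProd_strictMono : StrictMono partialProd := by
  refine strictMono_nat_of_lt_succ fun n => ?_
  rw [partialProd_succ]
  exact lt_mul_of_one_lt_right (partialProd_pos n) (by simp)

/-- The corrected product is nonincreasing: with `t = 2^n`, one step is `(1 + 1/(2t))(1 + 1/t) ≤ 1 +
2/t`. The constant `2` provides the slack; with `1` in its place the sequence would increase. -/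
lemma partialProd_mul_tail_le (k n : ℕ) (hn : 1 ≤ n) :
    partialProd (n + k) * (1 + 2 / (2 : ℝ) ^ (n + k)) ≤
      partialProd n * (1 + 2 / (2 : ℝ) ^ n) := by
  induction k with
  | zero => simp
  | succ k ih =>
    refine le_trans ?_ ih
    rw [← add_assoc, partialProd_succ, mul_assoc]
    refine mul_le_mul_of_nonneg_left ?_ (partialProd_pos _).le
    have h2 : (2 : ℝ) ≤ 2 ^ (n + k) := le_self_pow₀ (by norm_num) (by omega)
    set t : ℝ := (2 : ℝ) ^ (n + k) with ht
    rw [pow_succ, ← ht]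
    have h3 : (1 + 2 / t) - (1 + 1 / (t * 2)) * (1 + 2 / (t * 2)) = (t - 1) / (2 * t ^ 2) := by
      field_simp
      ring
    have h4 : 0 ≤ (t - 1) / (2 * t ^ 2) := by
      apply div_nonneg <;> nlinarith
    linarith

-- At index `32` the relative error `2 / 2^32` is below `5·10⁻¹⁰`, fine enough for the eight-digit
-- window.
lemma partialProd_le (n : ℕ) : partialProd n ≤ partialProd 32 * (1 + 2 / (2 : ℝ) ^ 32) := by
  calc partialProd n ≤ partialProd (32 + n) := partialProd_strictMono.monotone (by omega)
    _ ≤ partialProd (32 + n) * (1 + 2 / (2 : ℝ) ^ (32 + n)) :=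
      le_mul_of_one_le_right (partialProd_pos _).le (by simp; positivity)
    _ ≤ _ := partialProd_mul_tail_le n 32 (by norm_num)

lemma partialProd_bounds : 1 / 0.41942245 < partialProd 32 ∧
    partialProd 32 * (1 + 2 / (2 : ℝ) ^ 32) ≤ 1 / 0.41942244 := by
  have h : partialProd 32 = ∏ i ∈ Finset.range 32, (1 + 1 / (2 : ℝ) ^ (i + 1)) := by
    rw [partialProd, ← Finset.Ico_add_one_right_eq_Icc, Finset.prod_Ico_eq_prod_range]
    simp [add_comm]
  rw [h]
  constructor <;> norm_num [Finset.prod_range_succ]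

/-- The limit is the reciprocal of the supremum of the partial products. Strict monotonicity keeps
every partial product strictly below the supremum, so convergence is from above. -/
lemma exists_limit : ∃ L : ℝ, 0.41942244 ≤ L ∧ L < 0.41942245 ∧
    Tendsto (fun n => 1 / partialProd n) atTop (𝓝 L) ∧ ∀ n, L < 1 / partialProd n := by
  have hbdd : BddAbove (Set.range partialProd) := ⟨_, by rintro _ ⟨n, rfl⟩; exact partialProd_le n⟩
  have hlim := tendsto_atTop_ciSup partialProd_strictMono.monotone hbdd
  set A := ⨆ n, partialProd n with hA
  have hlt : ∀ n, partialProd n < A := fun n =>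
    (partialProd_strictMono n.lt_succ_self).trans_le (le_ciSup hbdd _)
  have hA0 : 0 < A := (partialProd_pos 0).trans (hlt 0)
  have hA1 : A ≤ 1 / 0.41942244 := (ciSup_le partialProd_le).trans partialProd_bounds.2
  have hA2 : 1 / 0.41942245 < A := partialProd_bounds.1.trans (hlt 32)
  refine ⟨1 / A, ?_, ?_, ?_, fun n => one_div_lt_one_div_of_lt (partialProd_pos n) (hlt n)⟩
  · exact (le_one_div (by norm_num) hA0).2 hA1
  · exact (one_div_lt (by norm_num) hA0).1 hA2
  · exact tendsto_const_nhds.div hlim hA0.ne'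

end CliffordUniform

end

theorem mainTheorem11 :
    (∀ n : ℕ, CliffordUniform.probUniform n =
      1 / ∏ i ∈ Finset.Icc 1 n, (1 + 1 / (2 : ℝ) ^ i)) ∧
    (∃ L : ℝ, 0.41942244 ≤ L ∧ L < 0.41942245 ∧
      Tendsto CliffordUniform.probUniform atTop (𝓝 L) ∧
      ∀ n : ℕ, L < CliffordUniform.probUniform n) ∧
    (∀ n : ℕ, 0.41 < CliffordUniform.probUniform n) := by
  obtain ⟨L, h1, h2, h3, h4⟩ := CliffordUniform.exists_limit
  have hP : CliffordUniform.probUniform = fun n => 1 / CliffordUniform.partialProd n :=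
    funext CliffordUniform.probUniform_eq
  refine ⟨CliffordUniform.probUniform_eq, ⟨L, h1, h2, ?_, ?_⟩, fun n => ?_⟩
  · rw [hP]; exact h3
  · rw [hP]; exact h4
  · rw [hP]
    exact lt_trans (lt_of_lt_of_le (by norm_num) h1) (h4 n)
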